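/- Let $\mathcal B\subseteq\mathbb R^d$ carry its Borel $\sigma$-algebra, and let $\mathcal H$ be a reproducing kernel Hilbert space of real-valued functions on $\mathcal B$ (a Hilbert space of functions $f:\mathcal B\to\mathbb R$ with continuous point evaluations; equivalently, the RKHS of a symmetric positive semidefinite kernel $K:\mathcal B\times\mathcal B\to\mathbb R$), all of whose elements are measurable. Let $p\in[1,\infty)$. For probability measures $\alpha,\beta$ on $\mathbb R$ let $$W_p(\alpha,\beta)=\Big(\inf_{\pi\in\Gamma(\alpha,\beta)}\int|x-y|^p\,\mathrm d\pi(x,y)\Big)^{1/p}\in[0,\infty],$$ where $\Gamma(\alpha,\beta)$ is the set of probability measures on $\mathbb R\times\mathbb R$ with marginals $\alpha$ and $\beta$. For probability measures $\mu,\nu$ on $\mathcal B$ define the kernel max-sliced (KMS) $p$-Wasserstein distance $$\mathcal{KMS}_p(\mu,\nu)=\sup_{f\in\mathcal H,\ \|f\|_{\mathcal H}\le 1}W_p(f_\#\mu,f_\#\nu)\in[0,\infty],$$ where $f_\#\mu$ is the pushforward of $\mu$ by $f$. Call $\mathcal H$ universal if all its elements are continuous and, for every compact $Z\subseteq\mathcal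 B$, every continuous $g:Z\to\mathbb R$ and every $\varepsilon>0$, there is $f\in\mathcal H$ with $|f(z)-g(z)|<\varepsilon$ for all $z\in Z$ (for compact $\mathcal B$: $\mathcal H$ is dense in $C(\mathcal B)$ in the supremum norm). Theorem (Metric Property of KMS). (i) For all probability measures $\mu,\nu,\rho$ on $\mathcal B$, $$\mathcal{KMS}_p(\mu,\rho)\le\mathcal{KMS}_p(\mu,\nu)+\mathcal{KMS}_p(\nu,\rho).$$ (ii) If, in addition, $\mathcal B$ is a Borel set and $\mathcal H$ is universal, then for all probability measures $\mu,\nu$ on $\mathcal B$, $\mathcal{KMS}_p(\mu,\nu)=0$ if and only if $\mu=\nu$. -/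

import Mathlib

open MeasureTheory
open scoped ENNReal

noncomputable section

/-- The couplings of `μ` and `ν`: probability measures on `V × V` with marginals `μ` and `ν`. -/
def couplings {V : Type*} [MeasurableSpace V] (μ ν : Measure V) : Set (Measure (V × V)) :=
  {π | IsProbabilityMeasure π ∧ π.map Prod.fst = μ ∧ π.map Prod.snd = ν}

/-- The `p`-Wasserstein distance between two probability measures on a normed space,
with values in `[0, ∞]` (no moment condition is imposed). -/
def wassersteinDist {V : Type*} [NormedAddCommGroup V] [MeasurableSpace V] (p : ℝ)
    (μ ν : Measure V) : ℝ≥0∞ :=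
  (⨅ π ∈ couplings μ ν, ∫⁻ z, ‖z.1 - z.2‖ₑ ^ p ∂π) ^ (1 / p)

/-- The kernel max-sliced `p`-Wasserstein distance for a reproducing kernel Hilbert space `H`
of real functions on `X`: the supremum, over the functions `f` in the closed unit ball of `H`,
of the `p`-Wasserstein distance between the pushforwards of `μ` and `ν` by `f : X → ℝ`. -/
def kmsDist {X : Type*} [MeasurableSpace X] (H : Type*) [NormedAddCommGroup H]
    [InnerProductSpace ℝ H] [RKHS ℝ H X ℝ] (p : ℝ) (μ ν : Measure X) : ℝ≥0∞ :=
  ⨆ f : H, ⨆ _ : ‖f‖ ≤ 1, wassersteinDist p (μ.map (f : X → ℝ)) (ν.map (f : X → ℝ))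

/-- A reproducing kernel Hilbert space of real functions on `X` is universal if it consists of
continuous functions and is dense in the continuous functions for the supremum norm on
every compact subset of `X`. For compact `X` this is density in `C(X, ℝ)` for the supremum
norm. -/
def IsUniversalRKHS {X : Type*} [TopologicalSpace X] (H : Type*) [NormedAddCommGroup H]
    [InnerProductSpace ℝ H] [RKHS ℝ H X ℝ] : Prop :=
  (∀ f : H, Continuous (f : X → ℝ)) ∧
    ∀ Z : Set X, IsCompact Z → ∀ g : C(Z, ℝ), ∀ ε : ℝ, 0 < ε →
      ∃ f : H, ∀ z : Z, |f (z : X) - g z| < ε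

end

/-!
The kernel max-sliced distance is a supremum of one-dimensional Wasserstein distances, so its
triangle inequality follows from that of `wassersteinDist`. There, two couplings sharing a marginal
are glued (`exists_gluing`) by disintegrating both over that marginal and taking the conditionally
independent product of the conditional laws; Minkowski's inequality in `L^p` of the glued measure
bounds the cost (`wassersteinDist_triangle`). Infima need not be attained: the inequality is proved
for every pair of couplings.

Both steps of the separation property use one criterion (`Measure.ext_of_isClosed_le_thickening`):
two probability measures `μ`, `ν` on a metric space agree once `μ F ≤ ν (thickening δ F) + ε` for
all closed `F` and all `δ, ε > 0`.

* If `W_p(α, β) = 0`, Markov's inequality shows that couplings of small cost give small mass to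
  `{‖x - y‖ ≥ δ}`, whence the criterion holds and `α = β` (`eq_of_wassersteinDist_eq_zero`).
* If the kernel max-sliced distance vanishes, then by the previous step and rescaling, `μ` and `ν`
  have the same image under every `f` in the RKHS. Take a compact `Z` carrying all but `ε` of both
  masses; it exists because a Borel subset of a Euclidean space carries only tight measures. For
  closed `F`, universality gives an `f` within `1 / 2` of `infDist · F / δ` on `Z`. Inside `Z`, the
  set `{f < 1 / 2}` contains `F` and is contained in `thickening δ F`; since it has the same mass
  under `μ` and `ν`, the criterion applies.
-/

open MeasureTheory ProbabilityTheory Filter Topology Metric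
open scoped ENNReal

/-! ### A thickening criterion for equality of probability measures -/

/-- Two probability measures agree if one is dominated by the other on closed sets up to an
arbitrarily small thickening and an arbitrarily small error. The hypothesis is one-sided: the
reverse domination follows by passing to complements of thickenings. -/
lemma MeasureTheory.Measure.ext_of_isClosed_le_thickening {X : Type*} [PseudoMetricSpace X]
    [MeasurableSpace X] [BorelSpace X] {μ ν : Measure X} [IsProbabilityMeasure μ]
    [IsProbabilityMeasure ν]
    (h : ∀ F, IsClosed F → ∀ δ : ℝ, 0 < δ → ∀ ε : ℝ≥0∞, 0 < ε → μ F ≤ ν (thickening δ F) + ε) :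
    μ = ν := by
  have lim : ∀ (m : Measure X) [IsProbabilityMeasure m] (F : Set X), IsClosed F →
      Tendsto (fun δ => m (thickening δ F)) (𝓝[>] 0) (𝓝 (m F)) := fun m _ F hF =>
    tendsto_measure_thickening_of_isClosed ⟨1, one_pos, measure_ne_top _ _⟩ hF
  have hle : ∀ F, IsClosed F → μ F ≤ ν F := by
    intro F hF
    refine ge_of_tendsto (lim ν F hF) ?_
    filter_upwards [self_mem_nhdsWithin] with δ hδ
    exact ENNReal.le_of_forall_pos_le_add fun ε hε _ => h F hF δ hδ ε (by exact_mod_cast hε)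
  have hge : ∀ F, IsClosed F → ν F ≤ μ F := by
    intro F hF
    refine ge_of_tendsto (lim μ F hF) ?_
    filter_upwards [self_mem_nhdsWithin] with δ hδ
    have hU : IsOpen (thickening δ F) := isOpen_thickening
    calc ν F ≤ ν (thickening δ F) := measure_mono (self_subset_thickening hδ F)
      _ = 1 - ν (thickening δ F)ᶜ := by
          rw [← prob_compl_eq_one_sub hU.measurableSet.compl, compl_compl]
      _ ≤ 1 - μ (thickening δ F)ᶜ := tsub_le_tsub_left (hle _ hU.isClosed_compl) _
      _ = μ (thickening δ F) := by
          rw [← prob_compl_eq_one_sub hU.measurableSet.compl, compl_compl]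
  refine ext_of_generate_finite _ ?_ isPiSystem_isClosed
    (fun F hF => le_antisymm (hle F hF) (hge F hF)) (by simp)
  rw [BorelSpace.measurable_eq (α := X), borel_eq_generateFrom_isClosed]

/-! ### The Wasserstein distance -/

section Wasserstein

variable {V : Type*} [NormedAddCommGroup V] [MeasurableSpace V] {p : ℝ}

lemma wassersteinDist_eq_iInf (hp : 0 < p) (α β : Measure V) :
    wassersteinDist p α β = ⨅ π ∈ couplings α β, (∫⁻ z, ‖z.1 - z.2‖ₑ ^ p ∂π) ^ (1 / p) := by
  have h := fun f : Measure (V × V) → ℝ≥0∞ =>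
    (ENNReal.orderIsoRpow (1 / p) (one_div_pos.2 hp)).map_iInf₂
      (fun π (_ : π ∈ couplings α β) => f π)
  exact h fun π => ∫⁻ z, ‖z.1 - z.2‖ₑ ^ p ∂π

lemma wassersteinDist_self (hp : 0 < p) (α : Measure V) [IsProbabilityMeasure α] :
    wassersteinDist p α α = 0 := by
  have hm : Measurable fun x : V => (x, x) := measurable_id.prodMk measurable_id
  have hdiag : α.map (fun x => (x, x)) ∈ couplings α α := by
    refine ⟨Measure.isProbabilityMeasure_map hm.aemeasurable, ?_, ?_⟩
    · rw [Measure.map_map measurable_fst hm]; exact Measure.map_id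
    · rw [Measure.map_map measurable_snd hm]; exact Measure.map_id
  rw [wassersteinDist_eq_iInf hp, ← nonpos_iff_eq_zero]
  refine (iInf₂_le _ hdiag).trans ?_
  refine (ENNReal.rpow_le_rpow (lintegral_map_le _ _) (by positivity)).trans ?_
  simp [hp]

/-- Gluing: two measures with the same first marginal are joint marginals of one measure, under
which their second coordinates are conditionally independent given the first. -/
lemma exists_gluing {X Y Z : Type*} [MeasurableSpace X] [MeasurableSpace Y] [MeasurableSpace Z]
    [StandardBorelSpace X] [Nonempty X] [StandardBorelSpace Z] [Nonempty Z]
    (π₁ : Measure (Y × X)) (π₂ : Measure (Y × Z)) [IsProbabilityMeasure π₁]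
    [IsProbabilityMeasure π₂] (h : π₁.fst = π₂.fst) :
    ∃ τ : Measure (Y × X × Z), IsProbabilityMeasure τ ∧
      τ.map (Prod.map id Prod.fst) = π₁ ∧ τ.map (Prod.map id Prod.snd) = π₂ := by
  refine ⟨π₁.fst ⊗ₘ (π₁.condKernel ×ₖ π₂.condKernel), inferInstance, ?_, ?_⟩
  · rw [← Measure.compProd_map measurable_fst, ← Kernel.fst_eq, Kernel.fst_prod,
      Measure.disintegrate]
  · rw [← Measure.compProd_map measurable_snd, ← Kernel.snd_eq, Kernel.snd_prod, h,
      Measure.disintegrate]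

lemma wassersteinDist_triangle [BorelSpace V] [SecondCountableTopology V] [StandardBorelSpace V]
    (hp : 1 ≤ p) (α β γ : Measure V) :
    wassersteinDist p α γ ≤ wassersteinDist p α β + wassersteinDist p β γ := by
  have hp0 : 0 < p := one_pos.trans_le hp
  simp only [wassersteinDist_eq_iInf hp0, ENNReal.iInf_add, ENNReal.add_iInf]
  refine le_iInf₂ fun π₂ h₂ => le_iInf₂ fun π₁ h₁ => ?_
  obtain ⟨_, h₁α, h₁β⟩ := h₁
  obtain ⟨_, h₂β, h₂γ⟩ := h₂
  have := Measure.isProbabilityMeasure_map (μ := π₁)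
    (measurable_swap (α := V) (β := V)).aemeasurable
  obtain ⟨τ, _, hτ₁, hτ₂⟩ := exists_gluing (π₁.map Prod.swap) π₂ (by
    rw [Measure.fst_map_swap, Measure.snd, Measure.fst, h₁β, h₂β])
  -- Coordinates of a point of `τ`: the middle one first, then the two outer ones.
  have hπ₁ : π₁ = τ.map fun w => (w.2.1, w.1) := by
    have := congrArg (Measure.map Prod.swap) hτ₁
    rw [Measure.map_map measurable_swap measurable_swap, Prod.swap_swap_eq, Measure.map_id,
      Measure.map_map measurable_swap (by fun_prop)] at this
    exact this.symm
  have hπ₂ : π₂ = τ.map fun w => (w.1, w.2.2) := hτ₂.symm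
  have hcost : Measurable fun z : V × V => ‖z.1 - z.2‖ₑ ^ p := by fun_prop
  have hglue : τ.map (fun w => w.2) ∈ couplings α γ := by
    refine ⟨Measure.isProbabilityMeasure_map (by fun_prop), ?_, ?_⟩
    · rw [← h₁α, hπ₁, Measure.map_map (by fun_prop) (by fun_prop),
        Measure.map_map (by fun_prop) (by fun_prop)]
      rfl
    · rw [← h₂γ, hπ₂, Measure.map_map (by fun_prop) (by fun_prop),
        Measure.map_map (by fun_prop) (by fun_prop)]
      rfl
  refine (iInf₂_le _ hglue).trans ?_
  rw [hπ₁, hπ₂, lintegral_map hcost (by fun_prop), lintegral_map hcost (by fun_prop),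
    lintegral_map hcost (by fun_prop)]
  have hf : AEMeasurable (fun w : V × V × V => ‖w.2.1 - w.1‖ₑ) τ := by fun_prop
  have hg : AEMeasurable (fun w : V × V × V => ‖w.1 - w.2.2‖ₑ) τ := by fun_prop
  refine le_trans ?_ (ENNReal.lintegral_Lp_add_le hf hg hp)
  gcongr with w
  rw [← sub_add_sub_cancel w.2.1 w.1 w.2.2]
  exact enorm_add_le _ _

lemma eq_of_wassersteinDist_eq_zero [BorelSpace V] [SecondCountableTopology V] (hp : 0 < p)
    {α β : Measure V} [IsProbabilityMeasure α] [IsProbabilityMeasure β]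
    (h : wassersteinDist p α β = 0) : α = β := by
  have hinf : ⨅ π ∈ couplings α β, ∫⁻ z, ‖z.1 - z.2‖ₑ ^ p ∂π = 0 :=
    (ENNReal.rpow_eq_zero_iff_of_pos (one_div_pos.2 hp)).1 h
  refine Measure.ext_of_isClosed_le_thickening fun F hF δ hδ ε hε => ?_
  have hd : 0 < ENNReal.ofReal δ ^ p :=
    ENNReal.rpow_pos (ENNReal.ofReal_pos.2 hδ) ENNReal.ofReal_ne_top
  have hd' : ENNReal.ofReal δ ^ p ≠ ∞ :=
    ENNReal.rpow_ne_top_of_nonneg hp.le ENNReal.ofReal_ne_top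
  have hlt : ⨅ π ∈ couplings α β, ∫⁻ z, ‖z.1 - z.2‖ₑ ^ p ∂π < ENNReal.ofReal δ ^ p * ε := by
    rw [hinf]
    exact ENNReal.mul_pos hd.ne' hε.ne'
  simp only [iInf_lt_iff] at hlt
  obtain ⟨π, ⟨_, hα, hβ⟩, hπ⟩ := hlt
  have hcost : Measurable fun z : V × V => ‖z.1 - z.2‖ₑ ^ p := by fun_prop
  have hU : IsOpen (thickening δ F) := isOpen_thickening
  have hmarkov : π {z | ENNReal.ofReal δ ^ p ≤ ‖z.1 - z.2‖ₑ ^ p} ≤ ε :=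
    (ENNReal.mul_le_mul_iff_right hd.ne' hd').1
      ((mul_meas_ge_le_lintegral hcost _).trans hπ.le)
  calc α F = π (Prod.fst ⁻¹' F) := by rw [← hα, Measure.map_apply measurable_fst hF.measurableSet]
    _ ≤ π (Prod.snd ⁻¹' thickening δ F ∪ {z | ENNReal.ofReal δ ^ p ≤ ‖z.1 - z.2‖ₑ ^ p}) := by
        refine measure_mono fun z hz => ?_
        by_contra hcon
        simp only [Set.mem_union, Set.mem_preimage, Set.mem_ofPred_eq, not_or, not_le,
          ENNReal.rpow_lt_rpow_iff hp] at hcon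
        refine hcon.1 (mem_thickening_iff.2 ⟨z.1, hz, ?_⟩)
        rw [dist_comm, dist_eq_norm]
        have := hcon.2
        rwa [← ofReal_norm, ENNReal.ofReal_lt_ofReal_iff hδ] at this
    _ ≤ π (Prod.snd ⁻¹' thickening δ F) + ε := (measure_union_le _ _).trans (by gcongr)
    _ = β (thickening δ F) + ε := by
        rw [← hβ, Measure.map_apply measurable_snd hU.measurableSet]

end Wasserstein

/-! ### Universal kernels separate probability measures -/

/-- A finite measure on a Borel subset of a Euclidean space is tight. -/
lemma exists_isCompact_compl_lt {d : ℕ} {B : Set (EuclideanSpace ℝ (Fin d))}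
    (hB : MeasurableSet B) (μ : Measure B) [IsFiniteMeasure μ] {ε : ℝ≥0∞} (hε : 0 < ε) :
    ∃ Z : Set B, IsCompact Z ∧ μ Zᶜ < ε := by
  obtain ⟨K, hKB, hK, hlt⟩ := hB.exists_isCompact_sdiff_lt
    (μ := μ.map Subtype.val) (measure_ne_top _ _) hε.ne'
  refine ⟨Subtype.val ⁻¹' K,
    Topology.IsInducing.subtypeVal.isCompact_preimage_iff (by simpa using hKB) |>.2 hK, ?_⟩
  rw [Measure.map_apply measurable_subtype_coe (hB.diff hK.measurableSet)] at hlt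
  refine (measure_mono fun x hx => ?_).trans_lt hlt
  exact ⟨x.2, hx⟩

section RKHS

variable {H X : Type*} [NormedAddCommGroup H] [InnerProductSpace ℝ H] [RKHS ℝ H X ℝ]

/-- A vanishing kernel max-sliced distance forces equal pushforwards along all elements of the
RKHS, not only those of the unit ball. -/
lemma map_eq_of_kmsDist_eq_zero [MeasurableSpace X] (hmeas : ∀ f : H, Measurable (f : X → ℝ))
    {p : ℝ} (hp : 0 < p) {μ ν : Measure X} [IsProbabilityMeasure μ] [IsProbabilityMeasure ν]
    (h : kmsDist H p μ ν = 0) (f : H) : μ.map (f : X → ℝ) = ν.map (f : X → ℝ) := by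
  have hc : 0 < ‖f‖ + 1 := by positivity
  set g : H := (‖f‖ + 1)⁻¹ • f with hg
  have hg1 : ‖g‖ ≤ 1 := by
    rw [hg, norm_smul, Real.norm_of_nonneg (by positivity), inv_mul_le_iff₀ hc]
    linarith
  have hfg : (f : X → ℝ) = (fun t : ℝ => (‖f‖ + 1) * t) ∘ (g : X → ℝ) := by
    ext x
    rw [Function.comp_apply, hg, RKHS.coe_smul, Pi.smul_apply, smul_eq_mul,
      mul_inv_cancel_left₀ hc.ne']
  have := Measure.isProbabilityMeasure_map (μ := μ) (hmeas g).aemeasurable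
  have := Measure.isProbabilityMeasure_map (μ := ν) (hmeas g).aemeasurable
  have hgeq : μ.map (g : X → ℝ) = ν.map (g : X → ℝ) :=
    eq_of_wassersteinDist_eq_zero hp <| nonpos_iff_eq_zero.1 <|
      h ▸ le_iSup₂ (f := fun (f : H) (_ : ‖f‖ ≤ 1) =>
        wassersteinDist p (μ.map (f : X → ℝ)) (ν.map (f : X → ℝ))) g hg1
  rw [hfg, ← Measure.map_map (by fun_prop) (hmeas g), hgeq,
    Measure.map_map (by fun_prop) (hmeas g)]

lemma IsUniversalRKHS.eq_of_map_eq [PseudoMetricSpace X] [MeasurableSpace X] [BorelSpace X]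
    (hH : IsUniversalRKHS (X := X) H) {μ ν : Measure X} [IsProbabilityMeasure μ]
    [IsProbabilityMeasure ν]
    (hμ : ∀ ε : ℝ≥0∞, 0 < ε → ∃ Z : Set X, IsCompact Z ∧ μ Zᶜ < ε)
    (hν : ∀ ε : ℝ≥0∞, 0 < ε → ∃ Z : Set X, IsCompact Z ∧ ν Zᶜ < ε)
    (h : ∀ f : H, μ.map (f : X → ℝ) = ν.map (f : X → ℝ)) : μ = ν := by
  refine Measure.ext_of_isClosed_le_thickening fun F hF δ hδ ε hε => ?_
  -- `infDist · ∅` is `0` by convention, so the empty set is treated apart.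
  rcases F.eq_empty_or_nonempty with rfl | hne
  · simp
  obtain ⟨Z₁, hZ₁, hμZ⟩ := hμ (ε / 2) (ENNReal.half_pos hε.ne')
  obtain ⟨Z₂, hZ₂, hνZ⟩ := hν (ε / 2) (ENNReal.half_pos hε.ne')
  obtain ⟨f, hf⟩ := hH.2 (Z₁ ∪ Z₂) (hZ₁.union hZ₂)
    ⟨fun z => infDist (z : X) F / δ, by fun_prop⟩ (1 / 2) (by norm_num)
  have hf' : ∀ x ∈ Z₁ ∪ Z₂, |f x - infDist x F / δ| < 1 / 2 := fun x hx => hf ⟨x, hx⟩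
  have hfm : Measurable (f : X → ℝ) := (hH.1 f).measurable
  have hhalf : μ {x | f x < 1 / 2} = ν {x | f x < 1 / 2} := by
    have := congrArg (fun m : Measure ℝ => m (Set.Iio (1 / 2))) (h f)
    simp only [Measure.map_apply hfm measurableSet_Iio] at this
    exact this
  calc μ F ≤ μ ({x | f x < 1 / 2} ∪ Z₁ᶜ) := by
        refine measure_mono fun x hx => ?_
        by_cases hxZ : x ∈ Z₁
        · have := hf' x (Or.inl hxZ)
          rw [infDist_zero_of_mem hx, zero_div, sub_zero] at this
          exact Or.inl (lt_of_abs_lt this)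
        · exact Or.inr hxZ
    _ ≤ ν {x | f x < 1 / 2} + ε / 2 := hhalf ▸ (measure_union_le _ _).trans (by gcongr)
    _ ≤ ν (thickening δ F ∪ Z₂ᶜ) + ε / 2 := by
        gcongr
        intro x hx
        by_cases hxZ : x ∈ Z₂
        · left
          have h1 := (abs_lt.1 (hf' x (Or.inr hxZ))).1
          have h2 : f x < 1 / 2 := hx
          have h3 : infDist x F / δ < 1 := by linarith
          obtain ⟨y, hy, hxy⟩ := (infDist_lt_iff hne).1 ((div_lt_one hδ).1 h3)
          exact mem_thickening_iff.2 ⟨y, hy, hxy⟩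
        · exact Or.inr hxZ
    _ ≤ ν (thickening δ F) + ε / 2 + ε / 2 := by
        gcongr
        exact (measure_union_le _ _).trans (by gcongr)
    _ = ν (thickening δ F) + ε := by rw [add_assoc, ENNReal.add_halves]

end RKHS

/-! ### The kernel max-sliced Wasserstein distance -/

theorem mainTheorem8 {d : ℕ} (B : Set (EuclideanSpace ℝ (Fin d)))
    (H : Type*) [NormedAddCommGroup H] [InnerProductSpace ℝ H] [CompleteSpace H]
    [RKHS ℝ H B ℝ] (hmeas : ∀ f : H, Measurable (f : B → ℝ))
    (p : ℝ) (hp : 1 ≤ p) :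
    (∀ μ ν ρ : Measure B, IsProbabilityMeasure μ → IsProbabilityMeasure ν →
      IsProbabilityMeasure ρ → kmsDist H p μ ρ ≤ kmsDist H p μ ν + kmsDist H p ν ρ) ∧
    (MeasurableSet B → IsUniversalRKHS H →
      ∀ μ ν : Measure B, IsProbabilityMeasure μ → IsProbabilityMeasure ν →
        (kmsDist H p μ ν = 0 ↔ μ = ν)) := by
  have hp0 : 0 < p := one_pos.trans_le hp
  refine ⟨fun μ ν ρ _ _ _ => ?_, fun hB hH μ ν _ _ => ⟨fun h => ?_, ?_⟩⟩
  · refine iSup₂_le fun f hf => (wassersteinDist_triangle hp _ (ν.map (f : B → ℝ)) _).trans ?_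
    exact add_le_add
      (le_iSup₂ (f := fun (f : H) (_ : ‖f‖ ≤ 1) =>
        wassersteinDist p (μ.map (f : B → ℝ)) (ν.map (f : B → ℝ))) f hf)
      (le_iSup₂ (f := fun (f : H) (_ : ‖f‖ ≤ 1) =>
        wassersteinDist p (ν.map (f : B → ℝ)) (ρ.map (f : B → ℝ))) f hf)
  · exact hH.eq_of_map_eq (fun _ => exists_isCompact_compl_lt hB μ)
      (fun _ => exists_isCompact_compl_lt hB ν) (map_eq_of_kmsDist_eq_zero hmeas hp0 h)
  · rintro rfl
    refine nonpos_iff_eq_zero.1 (iSup₂_le fun f _ => ?_)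
    have := Measure.isProbabilityMeasure_map (μ := μ) (hmeas f).aemeasurable
    exact (wassersteinDist_self hp0 _).le
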